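/- Call a tuple $(v;k_1,k_2,k_3,k_4;\lambda)$ of nonnegative integers with $v\ge 1$ and $k_i\le v$ for all $i$ a \emph{propus parameter set} if $$\sum_{i=1}^4 k_i(k_i-1)=\lambda(v-1),\qquad \lambda=k_1+k_2+k_3+k_4-v,\qquad k_2=k_3 .$$ (These are the necessary conditions on the parameters of a difference family with four base blocks of sizes $k_1,\dots,k_4$ in a group of order $v$, together with the two additional equations defining propus parameters; the existence of a difference family with these parameters is not required.) \textbf{Theorem 1.} For every odd integer $v>1$ there exist nonnegative integers $x,y,z,\lambda$ with $x,y,z<v/2$ such that $(v;x,y,y,z;\lambda)$ is a propus parameter set. -/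

import Mathlib

/-- The tuple `(v; k₁, …, kₘ; lam)` of nonnegative integers is a (feasible) *parameter set* for
difference families with `m` base blocks in a group of order `v`: the `k i` are possible sizes of
subsets of such a group, and `∑ i, k i * (k i - 1) = lam * (v - 1)`. -/
def IsParameterSet {m : ℕ} (v : ℕ) (k : Fin m → ℕ) (lam : ℕ) : Prop :=
  0 < v ∧ (∀ i, k i ≤ v) ∧
    ∑ i, (k i : ℤ) * ((k i : ℤ) - 1) = (lam : ℤ) * ((v : ℤ) - 1)

/-- A *GS-parameter set* is a parameter set with four block sizes such that
`lam = k₁ + k₂ + k₃ + k₄ - v`, the subtraction being that of the integers. -/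
def IsGSParameterSet (v : ℕ) (k : Fin 4 → ℕ) (lam : ℕ) : Prop :=
  IsParameterSet v k lam ∧ (lam : ℤ) = ∑ i, (k i : ℤ) - (v : ℤ)

/-- A *propus parameter set* is a GS-parameter set whose second and third block sizes
agree (the block sizes are indexed from `0`). -/
def IsPropusParameterSet (v : ℕ) (k : Fin 4 → ℕ) (lam : ℕ) : Prop :=
  IsGSParameterSet v k lam ∧ k 1 = k 2

/-! With `a = v - 2x`, `b = v - 2y`, `c = v - 2z`, the two equations amount to `a² + 2b² + c² = 4v`,
with `a, b, c` odd. If `2v = r² + s² + t²` with `r` and `s + t` odd, then `s + t, r, s - t` solve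
it.

Since `2v ≡ 2 (mod 4)`, three squares suffice by the classical argument: Dirichlet's theorem and
quadratic reciprocity yield a positive ternary form of determinant 1 representing `2v`, and Hermite
reduction turns any such form into a sum of three squares. -/

/-- Shifting an integer by a multiple of `a` brings it into `[-a/2, a/2]`. -/
lemma exists_two_mul_abs_add_mul_le {a : ℤ} (ha : 0 < a) (b : ℤ) :
    ∃ k : ℤ, 4 * (b + k * a) ^ 2 ≤ a ^ 2 := by
  have h1 := Int.emod_nonneg b ha.ne'
  have h2 := Int.emod_lt_of_pos b ha
  have h3 := Int.emod_add_mul_ediv b a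
  rcases le_total (2 * (b % a)) a with h | h
  · refine ⟨-(b / a), ?_⟩
    have : b + -(b / a) * a = b % a := by linear_combination -h3
    rw [this]
    nlinarith
  · refine ⟨-(b / a) - 1, ?_⟩
    have : b + (-(b / a) - 1) * a = b % a - a := by linear_combination -h3
    rw [this]
    nlinarith

/-- A positive definite binary form of determinant `D` is properly equivalent to one whose leading
coefficient is at most `√(4D/3)`. -/
lemma exists_binary_leading_coeff_le {D : ℤ} (hD : 0 < D) (N : ℕ) : ∀ A B C : ℤ, A.toNat = N →
    0 < A → A * C - B ^ 2 = D → ∃ p q r s : ℤ, p * s - q * r = 1 ∧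
      0 < A * p ^ 2 + 2 * B * p * r + C * r ^ 2 ∧
      3 * (A * p ^ 2 + 2 * B * p * r + C * r ^ 2) ^ 2 ≤ 4 * D := by
  induction N using Nat.strong_induction_on with
  | _ N ih =>
    intro A B C hN hA hdet
    obtain ⟨k, hk⟩ := exists_two_mul_abs_add_mul_le hA B
    have hdet' : A * (A * k ^ 2 + 2 * B * k + C) - (B + k * A) ^ 2 = D := by
      linear_combination hdet
    have hC : 0 < A * k ^ 2 + 2 * B * k + C := by
      by_contra! h
      nlinarith [sq_nonneg (B + k * A), mul_nonneg hA.le (neg_nonneg.mpr h)]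
    by_cases hlt : A * k ^ 2 + 2 * B * k + C < A
    · obtain ⟨p, q, r, s, h1, h2, h3⟩ := ih (A * k ^ 2 + 2 * B * k + C).toNat (by omega)
        (A * k ^ 2 + 2 * B * k + C) (-(B + k * A)) A rfl hC (by linear_combination hdet')
      have e : A * (k * p - r) ^ 2 + 2 * B * (k * p - r) * p + C * p ^ 2 =
          (A * k ^ 2 + 2 * B * k + C) * p ^ 2 + 2 * -(B + k * A) * p * r + A * r ^ 2 := by ring
      refine ⟨k * p - r, k * q - s, p, q, by linear_combination h1, ?_, ?_⟩
      · rw [e]; exact h2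
      · rw [e]; exact h3
    -- No further descent: `A² ≤ D + (B + k * A)² ≤ D + A² / 4`.
    · refine ⟨1, 0, 0, 1, by ring, by simpa using hA, ?_⟩
      have := mul_le_mul_of_nonneg_left (not_lt.mp hlt) hA.le
      nlinarith

/-- A positive definite binary form of determinant `1` represents only sums of two squares. -/
lemma binary_det_one_eq_sum_two_sq {A B C : ℤ} (hA : 0 < A) (hdet : A * C - B ^ 2 = 1)
    (y z : ℤ) : ∃ u w : ℤ, A * y ^ 2 + 2 * B * y * z + C * z ^ 2 = u ^ 2 + w ^ 2 := by
  obtain ⟨p, q, r, s, h, hpos, hle⟩ :=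
    exists_binary_leading_coeff_le one_pos A.toNat A B C rfl hA hdet
  have h1 : A * p ^ 2 + 2 * B * p * r + C * r ^ 2 = 1 := by nlinarith
  -- In the new basis the form is `Y² + 2MYZ + (M² + 1)Z² = (Y + MZ)² + Z²`.
  refine ⟨(s * y - q * z) + (A * p * q + B * (p * s + q * r) + C * r * s) * (p * z - r * y),
    p * z - r * y, ?_⟩
  set L := A * p ^ 2 + 2 * B * p * r + C * r ^ 2 with hL
  set M := A * p * q + B * (p * s + q * r) + C * r * s with hM
  set K := A * q ^ 2 + 2 * B * q * s + C * s ^ 2 with hK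
  have hd : L * K - M ^ 2 = 1 := by
    have : L * K - M ^ 2 = (A * C - B ^ 2) * (p * s - q * r) ^ 2 := by rw [hL, hM, hK]; ring
    rw [this, hdet, h]; norm_num
  have hKM : K = M ^ 2 + 1 := by rw [h1] at hd; linarith
  have hF : (A * y ^ 2 + 2 * B * y * z + C * z ^ 2) * (p * s - q * r) ^ 2 =
      L * (s * y - q * z) ^ 2 + 2 * M * (s * y - q * z) * (p * z - r * y)
        + K * (p * z - r * y) ^ 2 := by rw [hL, hM, hK]; ring
  rw [h, h1, hKM] at hF
  linear_combination hF

/-- Eliminating `G` gives `27 a³ ≤ 64`, so `a < 2`. The hypotheses are the reduction bounds for a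
ternary form with leading coefficient `a` and leading 2×2 minor `G`. -/
lemma eq_one_of_three_mul_sq_le {a G : ℤ} (ha : 0 < a) (h1 : 3 * a ^ 2 ≤ 4 * G)
    (h2 : 3 * G ^ 2 ≤ 4 * a) : a = 1 := by
  by_contra h
  have h3 : (3 * a ^ 2) ^ 2 ≤ (4 * G) ^ 2 := pow_le_pow_left₀ (by positivity) h1 2
  have h4 : a * (27 * a ^ 3) ≤ a * 64 := by linarith
  have h5 : 27 * a ^ 3 ≤ 64 := le_of_mul_le_mul_left h4 ha
  have h6 : (2 : ℤ) ^ 3 ≤ a ^ 3 := pow_le_pow_left₀ (by norm_num) (by omega) 3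
  linarith

/-- A positive definite integral ternary form of determinant `1` represents only sums of three
squares. -/
lemma ternary_det_one_eq_sum_three_sq (N : ℕ) : ∀ a b c d e g : ℤ, a.toNat = N → 0 < a →
    0 < a * b - g ^ 2 →
    a * b * c + 2 * d * e * g - a * d ^ 2 - b * e ^ 2 - c * g ^ 2 = 1 → ∀ x y z : ℤ,
    ∃ u v w : ℤ, a * x ^ 2 + b * y ^ 2 + c * z ^ 2 + 2 * d * y * z + 2 * e * x * z + 2 * g * x * y
      = u ^ 2 + v ^ 2 + w ^ 2 := by
  induction N using Nat.strong_induction_on with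
  | _ N ih =>
    intro a b c d e g hN ha hG hdet x y z
    by_cases ha1 : a = 1
    · subst ha1
      obtain ⟨u, w, h⟩ := binary_det_one_eq_sum_two_sq (A := b - g ^ 2) (B := d - g * e)
        (C := c - e ^ 2) (by linarith) (by linear_combination hdet) y z
      exact ⟨x + g * y + e * z, u, w, by linear_combination h⟩
    -- Completing the square, `a` times the form is `(ax + gy + ez)²` plus this binary form in `y,
    -- z`, of determinant `a`; reducing it makes the 2×2 minor small.
    obtain ⟨p, q, r, s, h, hpos, hle⟩ := exists_binary_leading_coeff_le ha _ (a * b - g ^ 2)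
      (a * d - g * e) (a * c - e ^ 2) rfl hG (by linear_combination a * hdet)
    obtain ⟨k, hk⟩ := exists_two_mul_abs_add_mul_le ha (g * p + e * r)
    set b₀ := b * p ^ 2 + 2 * d * p * r + c * r ^ 2 with hb₀
    set c₀ := b * q ^ 2 + 2 * d * q * s + c * s ^ 2 with hc₀
    set d₀ := b * p * q + d * (p * s + q * r) + c * r * s with hd₀
    set g₀ := g * p + e * r with hg₀
    set e₀ := g * q + e * s with he₀
    have hL : (a * b - g ^ 2) * p ^ 2 + 2 * (a * d - g * e) * p * r + (a * c - e ^ 2) * r ^ 2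
        = a * b₀ - g₀ ^ 2 := by rw [hb₀, hg₀]; ring
    rw [hL] at hpos hle
    have hdet₀ : a * b₀ * c₀ + 2 * d₀ * e₀ * g₀ - a * d₀ ^ 2 - b₀ * e₀ ^ 2 - c₀ * g₀ ^ 2 = 1 := by
      have : a * b₀ * c₀ + 2 * d₀ * e₀ * g₀ - a * d₀ ^ 2 - b₀ * e₀ ^ 2 - c₀ * g₀ ^ 2 =
          (a * b * c + 2 * d * e * g - a * d ^ 2 - b * e ^ 2 - c * g ^ 2)
            * (p * s - q * r) ^ 2 := by rw [hb₀, hc₀, hd₀, hg₀, he₀]; ring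
      rw [this, hdet, h]; norm_num
    have hF : a * x ^ 2 + (b * y ^ 2 + c * z ^ 2 + 2 * d * y * z) * (p * s - q * r) ^ 2
        + 2 * x * (e * z + g * y) * (p * s - q * r) =
        a * x ^ 2 + b₀ * (s * y - q * z) ^ 2 + c₀ * (p * z - r * y) ^ 2
        + 2 * d₀ * (s * y - q * z) * (p * z - r * y) + 2 * e₀ * x * (p * z - r * y)
        + 2 * g₀ * x * (s * y - q * z) := by rw [hb₀, hc₀, hd₀, hg₀, he₀]; ring
    rw [h] at hF
    set b₁ := a * k ^ 2 + 2 * g₀ * k + b₀ with hb₁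
    have hG₁ : a * b₁ - (g₀ + k * a) ^ 2 = a * b₀ - g₀ ^ 2 := by rw [hb₁]; ring
    have hlt : b₁ < a := by
      by_contra! hab
      have h1 : 3 * a ^ 2 ≤ 4 * (a * b₀ - g₀ ^ 2) := by
        linarith [mul_le_mul_of_nonneg_left hab ha.le, sq a]
      exact ha1 (eq_one_of_three_mul_sq_le ha h1 hle)
    have hb₁pos : 0 < b₁ :=
      pos_of_mul_pos_right (by linarith [sq_nonneg (g₀ + k * a)] : 0 < a * b₁) ha.le
    -- Swapping the first two variables puts the smaller `b₁` in the lead.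
    obtain ⟨u, v, w, huvw⟩ := ih b₁.toNat (by omega) b₁ a c₀ e₀ (d₀ + k * e₀) (g₀ + k * a) rfl
      hb₁pos (by linarith) (by rw [hb₁]; linear_combination hdet₀)
      (s * y - q * z) (x - k * (s * y - q * z)) (p * z - r * y)
    refine ⟨u, v, w, ?_⟩
    rw [← huvw, hb₁]
    linear_combination hF

/-- Positive integers congruent to `2` modulo `4` are sums of three squares. -/
lemma two_mul_odd_eq_sum_three_sq {m : ℕ} (hm : Odd m) :
    ∃ u v w : ℤ, (2 * m : ℤ) = u ^ 2 + v ^ 2 + w ^ 2 := by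
  obtain ⟨j, rfl⟩ := hm
  have hcop : Nat.Coprime (4 * j + 1) (4 * (4 * j + 2)) := by
    have h2 : Nat.Coprime (4 * j + 1) 4 := by
      simp [Nat.coprime_mul_right_add_left, mul_comm 4 j]
    have h3 : Nat.Coprime (4 * j + 1) (4 * j + 2) := by
      exact Nat.coprime_self_add_right (m := 4 * j + 1) (n := 1) |>.mpr (Nat.coprime_one_right _)
    exact h2.mul_right h3
  -- This residue class gives both `p ≡ 1 (mod 4)` and `p + 1 = (4k + 1)(4j + 2)`.
  obtain ⟨p, hp, hprime, hmod⟩ := Nat.forall_exists_prime_gt_and_eq_mod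
    (q := 4 * (4 * j + 2)) (a := ((4 * j + 1 : ℕ) : ZMod (4 * (4 * j + 2))))
    ((ZMod.isUnit_iff_coprime _ _).mpr hcop) (4 * j + 1)
  rw [ZMod.natCast_eq_natCast_iff] at hmod
  obtain ⟨k, hk⟩ := (Nat.modEq_iff_dvd' hp.le).mp hmod.symm
  have hpk : p + 1 = (4 * k + 1) * (4 * j + 2) := by
    have : p = 4 * j + 1 + 4 * (4 * j + 2) * k := by omega
    rw [this]; ring
  have : Fact p.Prime := ⟨hprime⟩
  have hp4 : p % 4 = 1 := by
    have : p = 4 * (j + (4 * j + 2) * k) + 1 := by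
      have : p = 4 * j + 1 + 4 * (4 * j + 2) * k := by omega
      rw [this]; ring
    omega
  -- By reciprocity, since `p ≡ -1 (mod 4k + 1)`.
  have hjac : jacobiSym (-((4 * k + 1 : ℕ) : ℤ)) p = 1 := by
    rw [neg_eq_neg_one_mul, jacobiSym.mul_left, jacobiSym.at_neg_one (by
      rw [Nat.odd_iff]; omega), ZMod.χ₄_nat_one_mod_four hp4, one_mul,
      jacobiSym.quadratic_reciprocity_one_mod_four' (by
        rw [Nat.odd_iff]; omega) hp4]
    have : jacobiSym (p : ℤ) (4 * k + 1) = jacobiSym (-1) (4 * k + 1) := by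
      apply jacobiSym.mod_left'
      apply Int.ModEq.symm
      rw [Int.modEq_iff_dvd]
      refine ⟨4 * j + 2, ?_⟩
      have := congrArg (Nat.cast : ℕ → ℤ) hpk
      push_cast at this ⊢
      linarith
    rw [this, jacobiSym.at_neg_one (by rw [Nat.odd_iff]; omega),
      ZMod.χ₄_nat_one_mod_four (by omega)]
  rw [← jacobiSym.legendreSym.to_jacobiSym] at hjac
  have hne : ((-((4 * k + 1 : ℕ) : ℤ) : ℤ) : ZMod p) ≠ 0 := by
    intro h0
    rw [(legendreSym.eq_zero_iff p _).mpr h0] at hjac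
    exact zero_ne_one hjac
  obtain ⟨t, ht⟩ := (legendreSym.eq_one_iff p hne).mp hjac
  obtain ⟨t, rfl⟩ := ZMod.intCast_surjective t
  have hdvd : (p : ℤ) ∣ t * t - -((4 * k + 1 : ℕ) : ℤ) := by
    rw [← ZMod.intCast_eq_intCast_iff_dvd_sub, ht]; push_cast; rfl
  obtain ⟨a, ha⟩ := hdvd
  have hpk' := congrArg (Nat.cast : ℕ → ℤ) hpk
  push_cast at ha hpk' ⊢
  have hppos : (0 : ℤ) < p := by exact_mod_cast hprime.pos
  have hapos : 0 < a := by
    by_contra! h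
    nlinarith [mul_nonneg hppos.le (neg_nonneg.mpr h), sq_nonneg t]
  -- As `a * p - t² = 4k + 1`, the determinant is `(4j + 2)(4k + 1) - p = 1`; the form takes the
  -- value `4j + 2` at `(0, 0, 1)`.
  obtain ⟨u, v, w, h⟩ := ternary_det_one_eq_sum_three_sq _ a p (4 * j + 2) 0 1 t rfl hapos
    (by nlinarith) (by linear_combination -hpk' - (4 * (j : ℤ) + 2) * ha) 0 0 1
  exact ⟨u, v, w, by linear_combination h⟩

/-- In a representation of `4 j + 2` as a sum of three squares exactly one square is even. -/
lemma exists_odd_sum_three_sq {m : ℕ} (hm : Odd m) :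
    ∃ r s t : ℤ, Odd r ∧ Odd (s + t) ∧ (2 * m : ℤ) = r ^ 2 + s ^ 2 + t ^ 2 := by
  obtain ⟨u, v, w, h⟩ := two_mul_odd_eq_sum_three_sq hm
  obtain ⟨j, rfl⟩ := hm
  push_cast at h
  rcases Int.even_or_odd' u with ⟨u', rfl | rfl⟩ <;> rcases Int.even_or_odd' v with ⟨v', rfl | rfl⟩
    <;> rcases Int.even_or_odd' w with ⟨w', rfl | rfl⟩ <;> ring_nf at h
  · omega
  · omega
  · omega
  · exact ⟨2 * v' + 1, 2 * w' + 1, 2 * u', ⟨v', rfl⟩, ⟨w' + u', by ring⟩, by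
      push_cast; linear_combination h⟩
  · omega
  · exact ⟨2 * u' + 1, 2 * w' + 1, 2 * v', ⟨u', rfl⟩, ⟨w' + v', by ring⟩, by
      push_cast; linear_combination h⟩
  · exact ⟨2 * u' + 1, 2 * v' + 1, 2 * w', ⟨u', rfl⟩, ⟨v' + w', by ring⟩, by
      push_cast; linear_combination h⟩
  · omega

/-- The natural number `k` with `|a| = v - 2 k`, for odd `v` and odd `a` with `a² ≤ v²`. -/
lemma exists_natCast_abs_eq_sub_two_mul {v : ℕ} (hv : Odd v) {a : ℤ} (ha : Odd a)
    (hle : a ^ 2 ≤ (v : ℤ) ^ 2) : ∃ k : ℕ, |a| = v - 2 * k ∧ 2 * k < v := by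
  have h1 : |a| ≤ v := abs_le_of_sq_le_sq hle (by positivity)
  obtain ⟨i, hi⟩ := hv
  obtain ⟨l, hl⟩ := odd_abs.mpr ha
  have h0 := abs_nonneg a
  refine ⟨(i - l).toNat, ?_, ?_⟩ <;> omega

theorem theorem1 (v : ℕ) (hodd : Odd v) (hv : 1 < v) :
    ∃ x y z lam : ℕ, IsPropusParameterSet v ![x, y, y, z] lam ∧
      (x : ℚ) < (v : ℚ) / 2 ∧ (y : ℚ) < (v : ℚ) / 2 ∧ (z : ℚ) < (v : ℚ) / 2 := by
  obtain ⟨r, s, t, hr, hst, h⟩ := exists_odd_sum_three_sq hodd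
  have hst' : Odd (s - t) := by
    have : s - t = (s + t) - 2 * t := by ring
    rw [this]; exact hst.sub_even (even_two_mul t)
  have hv3 : (3 : ℤ) ≤ v := by
    obtain ⟨i, hi⟩ := hodd
    omega
  have one_le_sq : ∀ {a : ℤ}, Odd a → 1 ≤ a ^ 2 := fun {a} ha => by
    have : a ≠ 0 := by rintro rfl; simp at ha
    have := sq_pos_of_ne_zero this
    omega
  have ha := one_le_sq hst
  have hb := one_le_sq hr
  have hc := one_le_sq hst'
  have hsum : (s + t) ^ 2 + 2 * r ^ 2 + (s - t) ^ 2 = 4 * v := by linear_combination -2 * h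
  -- The other squares are at least 1, so `(s + t)² ≤ 4v - 3 ≤ v²` for `v ≥ 3`.
  obtain ⟨x, hx, hxv⟩ := exists_natCast_abs_eq_sub_two_mul hodd hst (by nlinarith)
  obtain ⟨y, hy, hyv⟩ := exists_natCast_abs_eq_sub_two_mul hodd hr (by nlinarith)
  obtain ⟨z, hz, hzv⟩ := exists_natCast_abs_eq_sub_two_mul hodd hst' (by nlinarith)
  rw [← sq_abs (s + t), ← sq_abs r, ← sq_abs (s - t), hx, hy, hz] at hsum
  have hkey : (x : ℤ) * (x - 1) + y * (y - 1) + y * (y - 1) + z * (z - 1) =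
      (x + y + y + z - v) * (v - 1) := by linarith
  have hnn : ∀ k : ℕ, (0 : ℤ) ≤ k * (k - 1) := fun k => by
    rcases Nat.eq_zero_or_pos k with rfl | hk
    · simp
    · have : (1 : ℤ) ≤ k := by exact_mod_cast hk
      exact mul_nonneg (by positivity) (by linarith)
  have hlam : (0 : ℤ) ≤ x + y + y + z - v := by
    have := hnn x
    have := hnn y
    have := hnn z
    exact nonneg_of_mul_nonneg_left (b := (v : ℤ) - 1) (by linarith) (by linarith)
  have hhalf : ∀ {k : ℕ}, 2 * k < v → (k : ℚ) < (v : ℚ) / 2 := fun {k} hk => by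
    have : (2 * k : ℚ) < v := by exact_mod_cast hk
    linarith
  refine ⟨x, y, z, (x + y + y + z - v : ℤ).toNat, ⟨⟨⟨by omega, ?_, ?_⟩, ?_⟩, rfl⟩,
    hhalf hxv, hhalf hyv, hhalf hzv⟩
  · intro i
    fin_cases i <;> simp <;> omega
  · rw [Int.toNat_of_nonneg hlam, ← hkey]
    simp [Fin.sum_univ_four]
  · rw [Int.toNat_of_nonneg hlam]
    simp [Fin.sum_univ_four]
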